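/- Let $\|t\|$ denote the distance of a real number $t$ to the nearest integer. Let $k\ge 1$ be an integer. For $\underline{\zeta}=(\zeta_1,\dots,\zeta_k)\in\mathbb{R}^k$ let $\chi_k(\underline{\zeta})\in[-\infty,\infty]$ be the supremum of all real $\nu>0$ such that the system $$0<\min_{1\le j\le k}|x_j|\le\max_{1\le j\le k}|x_j|\le X,\qquad \max_{1\le j\le k}\|x_j\zeta_j\|\le X^{-\nu}$$ has a solution $(x_1,\dots,x_k)\in\mathbb{Z}^k$ for arbitrarily large real $X$. Let $T_k\subseteq\mathbb{R}^k$ be the set of all $\underline{\zeta}$ for which $1,\zeta_1,\dots,\zeta_k$ are linearly independent over $\mathbb{Q}$. Then the spectrum of $\chi_k$, i.e. the set of values taken by $\chi_k$ on $T_k$, is exactly $[1,\infty]$ (with $\infty$ included): $$\{\chi_k(\underline{\zeta}):\underline{\zeta}\in T_k\}=[1,\infty].$$ -/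

import Mathlib

open Filter

/-- The distance `‖t‖` of a real number `t` to the nearest integer. -/
noncomputable def distNearestInt (t : ℝ) : ℝ := |t - (round t : ℝ)|

/-- The set `𝒵ᵏ_ψ` of all `ζ ∈ ℝᵏ` such that, for arbitrarily large real `X`, the system
`0 < min_j |x_j| ≤ max_j |x_j| ≤ X`, `max_j ‖x_j ζ_j‖ ≤ ψ(X)` has a solution `x ∈ ℤᵏ`. -/
def approxSet (k : ℕ) (ψ : ℝ → ℝ) : Set (Fin k → ℝ) :=
  {ζ | ∃ᶠ X : ℝ in atTop, ∃ x : Fin k → ℤ,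
    (∀ j, 0 < |(x j : ℝ)| ∧ |(x j : ℝ)| ≤ X) ∧
    ∀ j, distNearestInt ((x j : ℝ) * ζ j) ≤ ψ X}

/-- The exponent `χ_k(ζ)`: the supremum in `[-∞, ∞]` of all real `ν > 0` such that
`ζ ∈ 𝒵ᵏ_ψ` for `ψ(t) = t ^ (-ν)`. -/
noncomputable def chi {k : ℕ} (ζ : Fin k → ℝ) : EReal :=
  sSup {e : EReal | ∃ ν : ℝ, 0 < ν ∧ ζ ∈ approxSet k (fun t => t ^ (-ν)) ∧ e = (ν : EReal)}

/-- The set `T_k` of all `ζ ∈ ℝᵏ` for which `1, ζ_1, …, ζ_k` are linearly independent over `ℚ`. -/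
def independentWithOne (k : ℕ) : Set (Fin k → ℝ) :=
  {ζ | LinearIndependent ℚ (Fin.cons 1 ζ : Fin (k + 1) → ℝ)}

/-- The spectrum of `χ_k`: the set of values taken by `χ_k` on `T_k`. -/
noncomputable def chiSpectrum (k : ℕ) : Set EReal :=
  {e | ∃ ζ ∈ independentWithOne k, chi ζ = e}

/-! Dirichlet's theorem, applied to one coordinate at a time, gives `1 ≤ χ_k`. For the converse, a
real number `ξ` of prescribed exponent is built from its continued fraction: if the denominators
satisfy `q (n + 1) ≍ 1 / ψ (q n)`, then `ξ` is `ψ`-approximable, but not better than that by more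
than a constant factor. The numbers `η` that are `ψ`-approximable along a given unbounded set of
`X` form a residual set, because every rational is such a number. A generic `η` is therefore also
independent of `1` and the coordinates chosen before, and can be appended to them without spoiling
the approximation. The exponent of the resulting vector is bounded above by that of its coordinate
`ξ`; for the value `∞` no upper bound is needed and all coordinates can be generic. -/

theorem distNearestInt_le_abs_sub (t : ℝ) (m : ℤ) : distNearestInt t ≤ |t - m| :=
  round_le t m

theorem distNearestInt_le_add_dist (s t : ℝ) :
    distNearestInt s ≤ distNearestInt t + dist s t :=
  (distNearestInt_le_abs_sub s (round t)).trans <|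
    (abs_sub_le s t (round t)).trans_eq (add_comm _ _)

theorem continuous_distNearestInt : Continuous distNearestInt :=
  (LipschitzWith.of_le_add distNearestInt_le_add_dist).continuous

theorem distNearestInt_intCast (m : ℤ) : distNearestInt m = 0 := by
  rw [distNearestInt, round_intCast, sub_self, abs_zero]

theorem distNearestInt_den_mul (r : ℚ) : distNearestInt (r.den * r) = 0 := by
  have hnum : (r.den * r : ℝ) = r.num := mod_cast Rat.den_mul_eq_num r
  rw [hnum, distNearestInt_intCast]

theorem irrational_of_forall_distNearestInt_pos {ξ : ℝ}
    (h : ∀ x : ℤ, x ≠ 0 → 0 < distNearestInt (x * ξ)) : Irrational ξ := by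
  rintro ⟨r, rfl⟩
  exact (h r.den (mod_cast r.den_ne_zero)).ne' (distNearestInt_den_mul r)

theorem inv_le_distNearestInt_div {m q : ℤ} (hq : 0 < q) (h : ¬q ∣ m) :
    (q : ℝ)⁻¹ ≤ distNearestInt (m / q) := by
  set r := round ((m : ℝ) / q) with hr
  have hq' : (0 : ℝ) < q := mod_cast hq
  have hne : m - r * q ≠ 0 := fun h0 => h ⟨r, by linarith⟩
  have hone : (1 : ℝ) ≤ |(m : ℝ) - r * q| := mod_cast Int.one_le_abs hne
  calc (q : ℝ)⁻¹ ≤ |(m : ℝ) - r * q| / q := by rw [inv_eq_one_div]; gcongr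
    _ = |((m : ℝ) - r * q) / q| := by rw [abs_div, abs_of_pos hq']
    _ = distNearestInt (m / q) := by
      rw [distNearestInt, ← hr, sub_div, mul_div_cancel_right₀ _ hq'.ne']

theorem inv_sub_le_distNearestInt_mul {p q x : ℤ} (hpq : IsCoprime q p) (hx : x ≠ 0)
    (hxq : |x| < q) (ξ : ℝ) :
    (q : ℝ)⁻¹ - |(x : ℝ)| * |ξ - p / q| ≤ distNearestInt (x * ξ) := by
  have hndvd : ¬q ∣ x * p := fun h =>
    hx (Int.eq_zero_of_abs_lt_dvd (hpq.dvd_of_dvd_mul_right h) hxq)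
  have hinv := inv_le_distNearestInt_div ((abs_nonneg x).trans_lt hxq) hndvd
  have hdist : dist (((x * p : ℤ) : ℝ) / q) (x * ξ) = |(x : ℝ)| * |ξ - p / q| := by
    rw [dist_comm, Real.dist_eq, ← abs_mul, Int.cast_mul, mul_div_assoc, mul_sub]
  linarith [distNearestInt_le_add_dist (((x * p : ℤ) : ℝ) / q) (x * ξ)]

theorem exists_forall_dist_le_of_dist_succ_le {α : Type*} [PseudoMetricSpace α] [CompleteSpace α]
    {u : ℕ → α} {e : ℕ → ℝ} {r : ℝ} (hr₀ : 0 ≤ r) (hr₁ : r < 1)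
    (hu : ∀ n, dist (u n) (u (n + 1)) ≤ e n) (he : ∀ n, e (n + 1) ≤ r * e n) :
    ∃ x, ∀ n, dist (u n) x ≤ e n / (1 - r) := by
  have hgeom (n m : ℕ) : dist (u (n + m)) (u (n + (m + 1))) ≤ e n * r ^ m :=
    (hu (n + m)).trans <| (le_geom (u := fun i => e (n + i)) hr₀ m fun i _ => he (n + i)).trans_eq
      (mul_comm _ _)
  have hcauchy : CauchySeq u :=
    cauchySeq_of_le_geometric r (e 0) hr₁ (by simpa only [zero_add] using hgeom 0)
  obtain ⟨x, hx⟩ := cauchySeq_tendsto_of_complete hcauchy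
  refine ⟨x, fun n => dist_le_of_le_geometric_of_tendsto₀ r (e n) hr₁ (hgeom n) ?_⟩
  simpa only [add_comm n] using (tendsto_add_atTop_iff_nat n).mpr hx

section ContinuedFraction

/-- The denominators `qₙ` of the convergents of the continued fraction `[0; a₁, a₂, …]` whose
partial quotients are produced by the rule `aₙ₊₁ = a qₙ`. Letting the next quotient depend on the
last denominator is what allows the growth of the denominators to be prescribed. -/
def convDen (a : ℕ → ℕ) : ℕ → ℕ
  | 0 => 1
  | 1 => a 1
  | n + 2 => a (convDen a (n + 1)) * convDen a (n + 1) + convDen a n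

/-- The numerators of the convergents whose denominators are given by `convDen a`. -/
def convNum (a : ℕ → ℕ) : ℕ → ℕ
  | 0 => 0
  | 1 => 1
  | n + 2 => a (convDen a (n + 1)) * convNum a (n + 1) + convNum a n

theorem convNum_mul_convDen_sub (a : ℕ → ℕ) (n : ℕ) :
    (convNum a (n + 1) * convDen a n - convNum a n * convDen a (n + 1) : ℤ) = (-1) ^ n := by
  induction n with
  | zero => simp [convNum, convDen]
  | succ n ih =>
    rw [pow_succ, ← ih, convNum, convDen]
    push_cast
    ring

theorem isCoprime_convDen_convNum (a : ℕ → ℕ) (n : ℕ) :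
    IsCoprime (convDen a n : ℤ) (convNum a n) := by
  have hsq : ((-1) ^ n * (-1) ^ n : ℤ) = 1 := by rw [← mul_pow, neg_one_mul, neg_neg, one_pow]
  refine ⟨(-1) ^ n * convNum a (n + 1), -(-1) ^ n * convDen a (n + 1), ?_⟩
  linear_combination (-1) ^ n * convNum_mul_convDen_sub a n + hsq

theorem mul_convDen_le_succ (a : ℕ → ℕ) (n : ℕ) :
    a (convDen a n) * convDen a n ≤ convDen a (n + 1) := by
  cases n <;> simp [convDen]

variable {a : ℕ → ℕ}

theorem convDen_pos (ha : ∀ b, 0 < b → 0 < a b) (n : ℕ) : 0 < convDen a n := by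
  induction n with
  | zero => exact one_pos
  | succ n ih => exact (Nat.mul_pos (ha _ ih) ih).trans_le (mul_convDen_le_succ a n)

theorem convDen_le_succ (ha : ∀ b, 0 < b → 0 < a b) (n : ℕ) : convDen a n ≤ convDen a (n + 1) :=
  (Nat.le_mul_of_pos_left _ (ha _ (convDen_pos ha n))).trans (mul_convDen_le_succ a n)

theorem convDen_succ_le (ha : ∀ b, 0 < b → 0 < a b) (n : ℕ) :
    convDen a (n + 1) ≤ (a (convDen a n) + 1) * convDen a n := by
  cases n with
  | zero => simp [convDen]
  | succ n =>
    rw [convDen, add_one_mul]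
    exact Nat.add_le_add_left (convDen_le_succ ha n) _

theorem dist_convergent_succ (ha : ∀ b, 0 < b → 0 < a b) (n : ℕ) :
    dist (convNum a n / convDen a n : ℝ) (convNum a (n + 1) / convDen a (n + 1)) =
      1 / (convDen a n * convDen a (n + 1)) := by
  have hn : (0 : ℝ) < convDen a n := mod_cast convDen_pos ha n
  have hn1 : (0 : ℝ) < convDen a (n + 1) := mod_cast convDen_pos ha (n + 1)
  have hdet : (convNum a (n + 1) * convDen a n - convDen a (n + 1) * convNum a n : ℝ) =
      (-1) ^ n := by
    rw [mul_comm (convDen a (n + 1) : ℝ)]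
    exact_mod_cast convNum_mul_convDen_sub a n
  rw [dist_comm, Real.dist_eq, div_sub_div _ _ hn1.ne' hn.ne', hdet, abs_div, abs_neg_one_pow,
    abs_of_pos (mul_pos hn1 hn), mul_comm (convDen a n : ℝ)]

theorem two_mul_convDen_le_succ (ha : ∀ b, 0 < b → 2 ≤ a b) (n : ℕ) :
    2 * convDen a n ≤ convDen a (n + 1) :=
  (Nat.mul_le_mul_right _ (ha _ (convDen_pos (fun b hb => two_pos.trans_le (ha b hb)) n))).trans
    (mul_convDen_le_succ a n)

theorem strictMono_convDen (ha : ∀ b, 0 < b → 2 ≤ a b) : StrictMono (convDen a) :=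
  strictMono_nat_of_lt_succ fun n => by
    have hpos := convDen_pos (fun b hb => two_pos.trans_le (ha b hb)) n
    linarith [two_mul_convDen_le_succ ha n]

theorem exists_convDen_le_and_lt_succ (ha : ∀ b, 0 < b → 2 ≤ a b) {m : ℕ} (hm : 0 < m) :
    ∃ n, convDen a n ≤ m ∧ m < convDen a (n + 1) := by
  obtain ⟨n, hn, hn'⟩ := (strictMono_convDen ha).exists_between_of_tendsto_atTop
    (strictMono_convDen ha).tendsto_atTop (Nat.lt_succ_of_le hm)
  exact ⟨n, Nat.le_of_lt_succ hn, hn'⟩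

theorem exists_forall_dist_convergent_le (ha : ∀ b, 0 < b → 2 ≤ a b) :
    ∃ ξ : ℝ, ∀ n, |ξ - convNum a n / convDen a n| ≤
      4 / (3 * (convDen a n * convDen a (n + 1))) := by
  have ha' : ∀ b, 0 < b → 0 < a b := fun b hb => two_pos.trans_le (ha b hb)
  have hpos (n : ℕ) : (0 : ℝ) < convDen a n := mod_cast convDen_pos ha' n
  have hdouble (n : ℕ) : 2 * (convDen a n : ℝ) ≤ convDen a (n + 1) :=
    mod_cast two_mul_convDen_le_succ ha n
  have hquarter (n : ℕ) : 1 / (convDen a (n + 1) * convDen a (n + 2) : ℝ) ≤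
      1 / 4 * (1 / (convDen a n * convDen a (n + 1))) := by
    have h₀ := hpos n
    have h₁ := hpos (n + 1)
    calc 1 / (convDen a (n + 1) * convDen a (n + 2) : ℝ)
        ≤ 1 / (2 * convDen a n * (2 * convDen a (n + 1))) := by
          gcongr
          exacts [hdouble n, hdouble (n + 1)]
      _ = 1 / 4 * (1 / (convDen a n * convDen a (n + 1))) := by field_simp; norm_num
  obtain ⟨ξ, hξ⟩ := exists_forall_dist_le_of_dist_succ_le (by norm_num) (by norm_num)
    (fun n => (dist_convergent_succ ha' n).le) hquarter
  refine ⟨ξ, fun n => ?_⟩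
  rw [← Real.dist_eq, dist_comm]
  refine (hξ n).trans_eq ?_
  have h₀ := hpos n
  have h₁ := hpos (n + 1)
  field_simp
  norm_num

theorem distNearestInt_convDen_mul_le {ξ : ℝ} {n : ℕ} (hn : 0 < convDen a n)
    (hξ : |ξ - convNum a n / convDen a n| ≤ 4 / (3 * (convDen a n * convDen a (n + 1)))) :
    distNearestInt (convDen a n * ξ) ≤ 4 / (3 * convDen a (n + 1)) := by
  have hn' : (0 : ℝ) < convDen a n := mod_cast hn
  calc distNearestInt (convDen a n * ξ) ≤ |convDen a n * ξ - (convNum a n : ℤ)| :=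
        distNearestInt_le_abs_sub _ _
    _ = convDen a n * |ξ - convNum a n / convDen a n| := by
        rw [← abs_of_pos hn', ← abs_mul, abs_of_pos hn', mul_sub, mul_div_cancel₀ _ hn'.ne',
          Int.cast_natCast]
    _ ≤ convDen a n * (4 / (3 * (convDen a n * convDen a (n + 1)))) := by gcongr
    _ = 4 / (3 * convDen a (n + 1)) := by field_simp

theorem inv_three_mul_convDen_le_distNearestInt (ha : ∀ b, 0 < b → 2 ≤ a b) {ξ : ℝ} {n : ℕ}
    (hξ : |ξ - convNum a n / convDen a n| ≤ 4 / (3 * (convDen a n * convDen a (n + 1))))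
    {x : ℤ} (hx : x ≠ 0) (hxn : |x| < convDen a n) :
    (3 * convDen a n : ℝ)⁻¹ ≤ distNearestInt (x * ξ) := by
  have hn : (0 : ℝ) < convDen a n := mod_cast (abs_nonneg x).trans_lt hxn
  have hdouble : 2 * (convDen a n : ℝ) ≤ convDen a (n + 1) :=
    mod_cast two_mul_convDen_le_succ ha n
  have hxn' : |(x : ℝ)| ≤ convDen a n := mod_cast hxn.le
  have herror : |(x : ℝ)| * |ξ - convNum a n / convDen a n| ≤ 2 / (3 * convDen a n) :=
    calc |(x : ℝ)| * |ξ - convNum a n / convDen a n|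
        ≤ convDen a n * (4 / (3 * (convDen a n * convDen a (n + 1)))) := by gcongr
      _ ≤ convDen a n * (4 / (3 * (convDen a n * (2 * convDen a n)))) := by gcongr
      _ = 2 / (3 * convDen a n) := by field_simp; norm_num
  calc (3 * convDen a n : ℝ)⁻¹ = (convDen a n : ℝ)⁻¹ - 2 / (3 * convDen a n) := by
        field_simp
        norm_num
    _ ≤ (convDen a n : ℝ)⁻¹ - |(x : ℝ)| * |ξ - convNum a n / convDen a n| := by gcongr
    _ ≤ distNearestInt (x * ξ) := by
        simpa only [Int.cast_natCast] using
          inv_sub_le_distNearestInt_mul (isCoprime_convDen_convNum a n) hx hxn ξ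

theorem exists_convDen_succ_mul_mem_Icc {ψ : ℕ → ℝ} (hpos : ∀ b, 0 < b → 0 < ψ b)
    (hle : ∀ b, 0 < b → b * ψ b ≤ 1) :
    ∃ a : ℕ → ℕ, (∀ b, 0 < b → 2 ≤ a b) ∧
      ∀ n, convDen a (n + 1) * ψ (convDen a n) ∈ Set.Icc 2 4 := by
  let a : ℕ → ℕ := fun b => ⌈2 / (b * ψ b)⌉₊
  have hbψ (b : ℕ) (hb : 0 < b) : 0 < b * ψ b := mul_pos (mod_cast hb) (hpos b hb)
  have ha (b : ℕ) (hb : 0 < b) : 2 ≤ a b := by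
    have : (2 : ℝ) ≤ a b :=
      ((le_div_iff₀ (hbψ b hb)).2 (by linarith [hle b hb])).trans (Nat.le_ceil _)
    exact_mod_cast this
  have ha' : ∀ b, 0 < b → 0 < a b := fun b hb => two_pos.trans_le (ha b hb)
  refine ⟨a, ha, fun n => ?_⟩
  have hq := convDen_pos ha' n
  have hlo : (a (convDen a n) * convDen a n : ℝ) ≤ convDen a (n + 1) :=
    mod_cast mul_convDen_le_succ a n
  have hhi : (convDen a (n + 1) : ℝ) ≤ (a (convDen a n) + 1) * convDen a n :=
    mod_cast convDen_succ_le ha' n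
  generalize convDen a n = b at *
  have hψ := (hpos b hq).le
  constructor
  · calc (2 : ℝ) ≤ a b * (b * ψ b) := (div_le_iff₀ (hbψ b hq)).1 (Nat.le_ceil _)
      _ ≤ convDen a (n + 1) * ψ b := by rw [← mul_assoc]; gcongr
  · have hceil : (a b : ℝ) * (b * ψ b) ≤ 2 + b * ψ b := by
      have := Nat.ceil_lt_add_one (div_pos two_pos (hbψ b hq)).le
      calc (a b : ℝ) * (b * ψ b) ≤ (2 / (b * ψ b) + 1) * (b * ψ b) := by
            gcongr
        _ = 2 + b * ψ b := by rw [add_one_mul, div_mul_cancel₀ _ (hbψ b hq).ne']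
    calc convDen a (n + 1) * ψ b ≤ (a b + 1) * b * ψ b := by gcongr
      _ = a b * (b * ψ b) + b * ψ b := by ring
      _ ≤ 4 := by linarith [hle b hq]

end ContinuedFraction

theorem exists_mem_approxSet_forall_mul_le_distNearestInt {ψ : ℝ → ℝ}
    (hpos : ∀ t, 1 ≤ t → 0 < ψ t) (hanti : AntitoneOn ψ (Set.Ici 1))
    (hle : ∀ t, 1 ≤ t → t * ψ t ≤ 1) :
    ∃ ξ : ℝ, (fun _ => ξ) ∈ approxSet 1 ψ ∧
      ∀ x : ℤ, x ≠ 0 → 12⁻¹ * ψ |(x : ℝ)| ≤ distNearestInt (x * ξ) := by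
  obtain ⟨a, ha, hψ⟩ := exists_convDen_succ_mul_mem_Icc (ψ := fun b => ψ b)
    (fun b hb => hpos b (mod_cast hb)) (fun b hb => hle b (mod_cast hb))
  obtain ⟨ξ, hξ⟩ := exists_forall_dist_convergent_le ha
  have hq (n : ℕ) : 0 < convDen a n := convDen_pos (fun b hb => two_pos.trans_le (ha b hb)) n
  have hq' (n : ℕ) : (0 : ℝ) < convDen a n := mod_cast hq n
  refine ⟨ξ, ?_, fun x hx => ?_⟩
  · refine (tendsto_natCast_atTop_atTop.comp (strictMono_convDen ha).tendsto_atTop).frequently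
      (Frequently.of_forall fun n => ⟨fun _ => convDen a n, fun _ => ?_, fun _ => ?_⟩)
    · simpa using hq n
    · have hq₁ := hq' (n + 1)
      calc distNearestInt (convDen a n * ξ) ≤ 4 / (3 * convDen a (n + 1)) :=
            distNearestInt_convDen_mul_le (hq n) (hξ n)
        _ ≤ ψ (convDen a n) := by
            rw [div_le_iff₀ (by positivity)]
            linarith [(hψ n).1]
  · obtain ⟨n, hn, hn'⟩ := exists_convDen_le_and_lt_succ ha (Int.natAbs_pos.2 hx)
    have hqx : (convDen a n : ℝ) ≤ |(x : ℝ)| := by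
      rw [← Int.cast_abs, ← Nat.cast_natAbs]
      exact_mod_cast hn
    have hxq : |x| < convDen a (n + 1) := by
      rw [Int.abs_eq_natAbs]
      exact_mod_cast hn'
    have hq1 : (1 : ℝ) ≤ convDen a n := mod_cast hq n
    calc 12⁻¹ * ψ |(x : ℝ)| ≤ 12⁻¹ * ψ (convDen a n) := by
          gcongr
          exact hanti hq1 (hq1.trans hqx) hqx
      _ ≤ 12⁻¹ * (4 / convDen a (n + 1)) := by
          gcongr
          rw [le_div_iff₀ (hq' _), mul_comm]
          exact (hψ n).2
      _ = (3 * convDen a (n + 1) : ℝ)⁻¹ := by field_simp; norm_num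
      _ ≤ distNearestInt (x * ξ) :=
          inv_three_mul_convDen_le_distNearestInt ha (hξ (n + 1)) hx hxq

theorem eventually_residual_frequently {ι X : Type*} [TopologicalSpace X] {l : Filter ι}
    [l.IsCountablyGenerated] {p : ι → X → Prop} (hopen : ∀ i, IsOpen {x | p i x})
    (hdense : Dense {x | ∃ᶠ i in l, p i x}) : ∀ᶠ x in residual X, ∃ᶠ i in l, p i x := by
  obtain ⟨s, hs⟩ := l.exists_antitone_basis
  refine residual_of_dense_Gδ ?_ hdense
  have hinter : {x | ∃ᶠ i in l, p i x} = ⋂ n, ⋃ i ∈ s n, {x | p i x} := by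
    ext x
    simp [hs.toHasBasis.frequently_iff]
  rw [hinter]
  exact IsGδ.iInter_of_isOpen fun n => isOpen_biUnion fun i _ => hopen i

section Extension

variable {k : ℕ} {ζ : Fin k → ℝ} {ψ : ℝ → ℝ}

theorem eventually_residual_snoc_mem_approxSet (hψ : ∀ᶠ X in atTop, 0 < ψ X)
    (hζ : ζ ∈ approxSet k ψ) :
    ∀ᶠ η in residual ℝ, (Fin.snoc ζ η : Fin (k + 1) → ℝ) ∈ approxSet (k + 1) ψ := by
  let p : ℝ → ℝ → Prop := fun X η =>
    (∃ x : Fin k → ℤ, (∀ j, 0 < |(x j : ℝ)| ∧ |(x j : ℝ)| ≤ X) ∧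
      ∀ j, distNearestInt (x j * ζ j) ≤ ψ X) ∧
    ∃ y : ℤ, (0 < |(y : ℝ)| ∧ |(y : ℝ)| ≤ X) ∧ distNearestInt (y * η) < ψ X
  have hopen (X : ℝ) : IsOpen {η | p X η} := by
    have hy (y : ℤ) : IsOpen {η : ℝ | distNearestInt (y * η) < ψ X} :=
      isOpen_lt (continuous_distNearestInt.comp (continuous_const_mul _)) continuous_const
    refine isOpen_const.and ?_
    simp only [Set.ofPred_exists]
    exact isOpen_iUnion fun y => isOpen_const.and (hy y)
  have hdense : Dense {η | ∃ᶠ X in atTop, p X η} := by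
    refine Rat.denseRange_cast.mono (Set.range_subset_iff.2 fun r => ?_)
    refine (hζ.and_eventually (hψ.and (eventually_ge_atTop (r.den : ℝ)))).mono ?_
    rintro X ⟨hx, hψX, hX⟩
    refine ⟨hx, r.den, by simpa using ⟨r.den_pos, hX⟩, ?_⟩
    rwa [Int.cast_natCast, distNearestInt_den_mul]
  filter_upwards [eventually_residual_frequently hopen hdense] with η hη
  refine hη.mono ?_
  rintro X ⟨⟨x, hx, hxζ⟩, y, hy, hyη⟩
  refine ⟨Fin.snoc x y, Fin.forall_fin_succ'.2 ⟨?_, ?_⟩, Fin.forall_fin_succ'.2 ⟨?_, ?_⟩⟩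
  · simpa using hx
  · simpa using hy
  · simpa using hxζ
  · simpa using hyη.le

theorem eventually_residual_snoc_mem_independentWithOne (hζ : ζ ∈ independentWithOne k) :
    ∀ᶠ η in residual ℝ, (Fin.snoc ζ η : Fin (k + 1) → ℝ) ∈ independentWithOne (k + 1) := by
  let V : Submodule ℚ ℝ := Submodule.span ℚ (Set.range (Fin.cons 1 ζ : Fin (k + 1) → ℝ))
  have hcountable : (V : Set ℝ).Countable := by
    simp only [V, ← Fintype.range_linearCombination ℚ]
    exact Set.countable_range _
  have hresidual : (V : Set ℝ)ᶜ ∈ residual ℝ :=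
    residual_of_dense_Gδ hcountable.isGδ_compl (hcountable.dense_compl ℝ)
  filter_upwards [hresidual] with η hη
  change LinearIndependent ℚ (Fin.cons 1 (Fin.snoc ζ η) : Fin (k + 1 + 1) → ℝ)
  rw [Fin.cons_snoc_eq_snoc_cons]
  exact LinearIndependent.finSnoc hζ hη

theorem exists_extension_mem_independentWithOne_inter_approxSet
    (hψ : ∀ᶠ X in atTop, 0 < ψ X) (hζ : ζ ∈ independentWithOne k ∩ approxSet k ψ) {l : ℕ}
    (hkl : k ≤ l) :
    ∃ ζ' ∈ independentWithOne l ∩ approxSet l ψ, ∀ j, ζ' (Fin.castLE hkl j) = ζ j := by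
  induction l, hkl using Nat.le_induction with
  | base => exact ⟨ζ, hζ, fun j => rfl⟩
  | succ l hkl ih =>
    obtain ⟨ζ', ⟨hind, happrox⟩, hext⟩ := ih
    obtain ⟨η, hη⟩ := (dense_of_mem_residual <|
      (eventually_residual_snoc_mem_independentWithOne hind).and
        (eventually_residual_snoc_mem_approxSet hψ happrox)).nonempty
    exact ⟨Fin.snoc ζ' η, hη, fun j =>
      (Fin.snoc_castSucc (α := fun _ => ℝ) η ζ' (Fin.castLE hkl j)).trans (hext j)⟩

end Extension

theorem mem_independentWithOne_zero (ζ : Fin 0 → ℝ) : ζ ∈ independentWithOne 0 :=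
  (linearIndependent_unique_iff (ι := Fin 1)).2 one_ne_zero

theorem mem_approxSet_zero (ζ : Fin 0 → ℝ) (ψ : ℝ → ℝ) : ζ ∈ approxSet 0 ψ :=
  Frequently.of_forall fun _ => ⟨0, fun j => j.elim0, fun j => j.elim0⟩

theorem const_mem_independentWithOne_one {ξ : ℝ} (hξ : Irrational ξ) :
    (fun _ => ξ) ∈ independentWithOne 1 := by
  have hpair : LinearIndependent ℚ ![1, ξ] :=
    (LinearIndependent.pair_iff' one_ne_zero).2 fun r hr =>
      hξ ⟨r, by rw [← hr, Rat.smul_one_eq_cast]⟩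
  change LinearIndependent ℚ (Fin.cons 1 fun _ => ξ)
  convert! hpair using 1
  ext i
  fin_cases i <;> rfl

section Exponent

variable {k : ℕ} {ζ : Fin k → ℝ}

theorem approxSet_subset_of_eventuallyLE {ψ φ : ℝ → ℝ} (h : ψ ≤ᶠ[atTop] φ) :
    approxSet k ψ ⊆ approxSet k φ := fun _ hζ =>
  (hζ.and_eventually h).mono fun _ ⟨⟨x, hx, hxζ⟩, hX⟩ => ⟨x, hx, fun j => (hxζ j).trans hX⟩

theorem le_chi {ν : ℝ} (hν : 0 < ν) (h : ζ ∈ approxSet k fun t => t ^ (-ν)) :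
    (ν : EReal) ≤ chi ζ :=
  le_sSup ⟨ν, hν, h, rfl⟩

theorem mem_approxSet_rpow_neg_one (ζ : Fin k → ℝ) : ζ ∈ approxSet k fun t => t ^ (-1 : ℝ) := by
  refine tendsto_natCast_atTop_atTop.frequently (Eventually.frequently ?_)
  filter_upwards [eventually_gt_atTop 0] with n hn
  choose x hx_pos hx_le hx using fun j => Real.exists_nat_abs_mul_sub_round_le (ζ j) hn
  refine ⟨fun j => x j, fun j => by simpa using ⟨hx_pos j, hx_le j⟩, fun j => ?_⟩
  have : (0 : ℝ) < n := mod_cast hn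
  calc distNearestInt (x j * ζ j) ≤ 1 / (n + 1) := hx j
    _ ≤ (n : ℝ) ^ (-1 : ℝ) := by
      rw [Real.rpow_neg_one, ← one_div]
      gcongr
      linarith

theorem one_le_chi (ζ : Fin k → ℝ) : 1 ≤ chi ζ :=
  le_chi one_pos (mem_approxSet_rpow_neg_one ζ)

theorem chi_le_of_forall_mul_rpow_le {c w : ℝ} (hc : 0 < c) (hw : 0 ≤ w) (j : Fin k)
    (h : ∀ x : ℤ, x ≠ 0 → c * |(x : ℝ)| ^ (-w) ≤ distNearestInt (x * ζ j)) : chi ζ ≤ w := by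
  refine sSup_le ?_
  rintro _ ⟨ν, -, hν, rfl⟩
  rw [EReal.coe_le_coe_iff]
  by_contra! hwν
  have hsmall : ∀ᶠ X : ℝ in atTop, X ^ (-(ν - w)) < c :=
    (tendsto_rpow_neg_atTop (sub_pos.2 hwν)).eventually_lt_const hc
  obtain ⟨X, ⟨x, hx, hxζ⟩, hX⟩ := (hν.and_eventually hsmall).exists
  obtain ⟨hx_pos, hx_le⟩ := hx j
  have hX_pos : 0 < X := hx_pos.trans_le hx_le
  have hX_lt : X ^ (-ν) < X ^ (-ν) :=
    calc X ^ (-ν) = X ^ (-(ν - w)) * X ^ (-w) := by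
          rw [← Real.rpow_add hX_pos]
          ring_nf
      _ < c * X ^ (-w) := by gcongr
      _ ≤ c * |(x j : ℝ)| ^ (-w) := by
          gcongr c * ?_
          exact Real.rpow_le_rpow_of_nonpos hx_pos hx_le (neg_nonpos.2 hw)
      _ ≤ distNearestInt (x j * ζ j) := h _ (Int.cast_ne_zero.1 (abs_pos.1 hx_pos))
      _ ≤ X ^ (-ν) := hxζ j
  exact hX_lt.false

theorem chi_eq_top_of_mem_approxSet (h : ζ ∈ approxSet k fun t => t ^ (-t)) : chi ζ = ⊤ := by
  refine (EReal.eq_top_iff_forall_lt _).2 fun b => ?_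
  have hb : b < max b 0 + 1 := (le_max_left b 0).trans_lt (lt_add_one _)
  refine (EReal.coe_lt_coe_iff.2 hb).trans_le (le_chi (by positivity) ?_)
  refine approxSet_subset_of_eventuallyLE ?_ h
  filter_upwards [eventually_ge_atTop 1, eventually_ge_atTop (max b 0 + 1)] with X hX hbX
  exact Real.rpow_le_rpow_of_exponent_le hX (neg_le_neg hbX)

end Exponent

theorem exists_irrational_forall_mul_rpow_le {w : ℝ} (hw : 1 ≤ w) :
    ∃ ξ : ℝ, Irrational ξ ∧ (fun _ => ξ) ∈ approxSet 1 (fun t => t ^ (-w)) ∧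
      ∀ x : ℤ, x ≠ 0 → 12⁻¹ * |(x : ℝ)| ^ (-w) ≤ distNearestInt (x * ξ) := by
  have hpos (t : ℝ) (ht : 1 ≤ t) : 0 < t ^ (-w) := Real.rpow_pos_of_pos (one_pos.trans_le ht) _
  have hanti : AntitoneOn (fun t : ℝ => t ^ (-w)) (Set.Ici 1) := fun s hs t _ hst =>
    Real.rpow_le_rpow_of_nonpos (one_pos.trans_le hs) hst (by linarith)
  have hle (t : ℝ) (ht : 1 ≤ t) : t * t ^ (-w) ≤ 1 := by
    have ht₀ : 0 < t := one_pos.trans_le ht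
    calc t * t ^ (-w) = t ^ (1 - w) := by rw [sub_eq_add_neg, Real.rpow_add ht₀, Real.rpow_one]
      _ ≤ 1 := Real.rpow_le_one_of_one_le_of_nonpos ht (sub_nonpos.2 hw)
  obtain ⟨ξ, happrox, hlower⟩ :=
    exists_mem_approxSet_forall_mul_le_distNearestInt hpos hanti hle
  refine ⟨ξ, irrational_of_forall_distNearestInt_pos fun x hx => ?_, happrox, hlower⟩
  have : (0 : ℝ) < |(x : ℝ)| := abs_pos.2 (Int.cast_ne_zero.2 hx)
  exact lt_of_lt_of_le (by positivity) (hlower x hx)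

theorem coe_mem_chiSpectrum {k : ℕ} (hk : 1 ≤ k) {w : ℝ} (hw : 1 ≤ w) :
    (w : EReal) ∈ chiSpectrum k := by
  have hw₀ : 0 < w := one_pos.trans_le hw
  obtain ⟨ξ, hirrational, happrox, hlower⟩ := exists_irrational_forall_mul_rpow_le hw
  have hψ : ∀ᶠ X : ℝ in atTop, 0 < X ^ (-w) :=
    (eventually_gt_atTop 0).mono fun X hX => Real.rpow_pos_of_pos hX _
  obtain ⟨ζ, ⟨hind, hζ⟩, hext⟩ := exists_extension_mem_independentWithOne_inter_approxSet hψ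
    ⟨const_mem_independentWithOne_one hirrational, happrox⟩ hk
  refine ⟨ζ, hind, le_antisymm ?_ (le_chi hw₀ hζ)⟩
  refine chi_le_of_forall_mul_rpow_le (c := 12⁻¹) (by norm_num) hw₀.le (Fin.castLE hk 0) ?_
  rwa [hext 0]

theorem top_mem_chiSpectrum (k : ℕ) : ⊤ ∈ chiSpectrum k := by
  have hψ : ∀ᶠ X : ℝ in atTop, 0 < X ^ (-X) :=
    (eventually_gt_atTop 0).mono fun X hX => Real.rpow_pos_of_pos hX _
  obtain ⟨ζ, ⟨hind, hζ⟩, -⟩ := exists_extension_mem_independentWithOne_inter_approxSet hψ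
    ⟨mem_independentWithOne_zero ![], mem_approxSet_zero ![] _⟩ k.zero_le
  exact ⟨ζ, hind, chi_eq_top_of_mem_approxSet hζ⟩

theorem mainTheorem5 (k : ℕ) (hk : 1 ≤ k) :
    chiSpectrum k = Set.Icc (1 : EReal) ⊤ := by
  refine Set.Subset.antisymm ?_ ?_
  · rintro _ ⟨ζ, -, rfl⟩
    exact ⟨one_le_chi ζ, le_top⟩
  · rintro e ⟨he, -⟩
    induction e with
    | bot => exact absurd (le_bot_iff.1 he) (EReal.coe_ne_bot 1)
    | coe w => exact coe_mem_chiSpectrum hk (mod_cast he)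
    | top => exact top_mem_chiSpectrum k
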